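/- For a finite simple graph $G$ with vertex set $V(G)$, let $S(G)$ be the set of real symmetric matrices $A=(a_{uv})$, with rows and columns indexed by $V(G)$, such that for all $u\ne v$ one has $a_{uv}\neq 0$ if and only if $\{u,v\}$ is an edge of $G$ (the diagonal entries are arbitrary). Let $q(A)$ be the number of distinct eigenvalues of $A$, and let $q(G)=\min\{q(A) : A\in S(G)\}$. Theorem. Let $G$ be a connected graph on $n=|V(G)|\le 5$ vertices. Then $q(G)=|V(G)|-1$ if and only if $G$ is isomorphic to one of the following graphs: (a) the graph with vertices $v_1,\dots,v_n$ and edge set $\{\{v_1,v_2\},\{v_2,v_3\},\dots,\{v_{n-1},v_n\},\{v_i,v_{i+2}\}\}$ for some $i$ with $1\le i\le n-2$; (b) the graph with vertices $v_1,\dots,v_n$ and edge set $\{\{v_1,v_2\},\{v_2,v_3\},\dots,\{v_{n-2},v_{n-1}\},\{v_i,v_n\}\}$ for some $i$ with $2\le i\le n-2$. -/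

import Mathlib

/-!
For a symmetric matrix `A` the number `q(A)` is the degree of the minimal polynomial. If
`p₀, …, p_d` is the only shortest path from `p₀` to each of its vertices, then for `A` in `S(G)` the
entry of `A ^ k` at `(p₀, p_k)` is nonzero while those of all lower powers vanish, so `q(A) > d`. On
the other hand a matrix of rank `r` has at most `r + 1` distinct eigenvalues, and covering `G` by
cliques (rank one each) and complete bipartite graphs (rank two each) produces a matrix of small
rank in `S(G)`. Together these estimates give `q(G) = n - 1` for both families and every `n`, and
the first one gives `q(P_n) ≥ n` for the path.

Every connected graph on `n + 1` vertices arises from one on `n` vertices by attaching a vertex.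
A finite check based on this shows that for `n ≤ 5` each remaining connected graph is the graph of
one of twenty integer matrices, annihilated by monic polynomials of degree `n - 2`.
-/

/-- `S(G)`: the real symmetric matrices, indexed by the vertices of `G`, whose off-diagonal
entries are nonzero exactly at the edges of `G`; the diagonal entries are arbitrary. -/
def SymMatricesOf {V : Type*} (G : SimpleGraph V) : Set (Matrix V V ℝ) :=
  {A | A.IsSymm ∧ ∀ i j, i ≠ j → (A i j ≠ 0 ↔ G.Adj i j)}

/-- `q(A)`: the number of distinct (real) eigenvalues of a real square matrix `A`. It is only
used for symmetric `A`, all of whose eigenvalues are real. -/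
noncomputable def numDistinctEigenvalues {V : Type*} [Fintype V] [DecidableEq V]
    (A : Matrix V V ℝ) : ℕ :=
  {μ : ℝ | Module.End.HasEigenvalue (Matrix.toLin' A) μ}.ncard

/-- The family `S(G)` is nonempty (it contains the adjacency matrix). -/
theorem symMatricesOf_nonempty {V : Type*} (G : SimpleGraph V) :
    (SymMatricesOf G).Nonempty := by
  classical
  exact ⟨G.adjMatrix ℝ, G.isSymm_adjMatrix, fun i j _ => by simp [SimpleGraph.adjMatrix_apply]⟩

/-- `q(G)`: the minimum of `q(A)` over all `A` in `S(G)`. -/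
noncomputable def minDistinctEigenvalues {V : Type*} [Fintype V] [DecidableEq V]
    (G : SimpleGraph V) : ℕ :=
  sInf (numDistinctEigenvalues '' SymMatricesOf G)

/-- The graph on `v_1, …, v_n` with edges `{v_1, v_2}, …, {v_{n-1}, v_n}` and `{v_i, v_{i+2}}`.
The element `a` of `Fin n` stands for the vertex `v_{a+1}`; used for `1 ≤ i ≤ n - 2`. -/
def pathWithChord (n i : ℕ) : SimpleGraph (Fin n) :=
  SimpleGraph.fromRel fun a b =>
    a.val + 1 = b.val ∨ (a.val + 1 = i ∧ b.val + 1 = i + 2)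

/-- The graph on `v_1, …, v_n` with edges `{v_1, v_2}, …, {v_{n-2}, v_{n-1}}` and `{v_i, v_n}`.
The element `a` of `Fin n` stands for the vertex `v_{a+1}`; used for `2 ≤ i ≤ n - 2`. -/
def pathWithPendant (n i : ℕ) : SimpleGraph (Fin n) :=
  SimpleGraph.fromRel fun a b =>
    (a.val + 1 = b.val ∧ b.val + 1 < n) ∨ (a.val + 1 = i ∧ b.val + 1 = n)

open Polynomial SimpleGraph

section Spectrum

variable {V W : Type*} [Fintype V] [DecidableEq V] [Fintype W] [DecidableEq W]

theorem setOf_hasEigenvalue_eq_rootSet_minpoly (A : Matrix V V ℝ) :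
    {μ | Module.End.HasEigenvalue (Matrix.toLin' A) μ} = (minpoly ℝ A).rootSet ℝ := by
  ext μ
  simp only [Set.mem_ofPred_eq, Module.End.hasEigenvalue_iff_isRoot, Matrix.minpoly_toLin',
    mem_rootSet_of_ne (minpoly.ne_zero (Matrix.isIntegral A)), IsRoot.def, coe_aeval_eq_eval]

theorem numDistinctEigenvalues_le_natDegree {A : Matrix V V ℝ} {p : ℝ[X]} (hp : p ≠ 0)
    (h : aeval A p = 0) : numDistinctEigenvalues A ≤ p.natDegree :=
  calc numDistinctEigenvalues A = ((minpoly ℝ A).rootSet ℝ).ncard := by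
        rw [numDistinctEigenvalues, setOf_hasEigenvalue_eq_rootSet_minpoly]
    _ ≤ (minpoly ℝ A).natDegree := ncard_rootSet_le _ _
    _ ≤ p.natDegree := natDegree_le_of_dvd (minpoly.dvd ℝ A h) hp

theorem splits_minpoly_of_isHermitian {A : Matrix V V ℝ} (hA : A.IsHermitian) :
    (minpoly ℝ A).Splits :=
  hA.splits_charpoly.of_dvd A.charpoly_monic.ne_zero (Matrix.minpoly_dvd_charpoly A)

theorem separable_minpoly_of_isHermitian {A : Matrix V V ℝ} (hA : A.IsHermitian) :
    (minpoly ℝ A).Separable := by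
  have hss := (Matrix.isSymmetric_toEuclideanLin_iff.mpr hA).isFinitelySemisimple
  rw [Module.End.isFinitelySemisimple_iff_isSemisimple] at hss
  have hsq := hss.minpoly_squarefree
  rw [Matrix.toEuclideanLin_eq_toLin_orthonormal, Matrix.minpoly_toLin] at hsq
  exact PerfectField.separable_iff_squarefree.mpr hsq

theorem numDistinctEigenvalues_eq_natDegree_minpoly {A : Matrix V V ℝ} (hA : A.IsSymm) :
    numDistinctEigenvalues A = (minpoly ℝ A).natDegree := by
  have hH : A.IsHermitian := by
    rwa [Matrix.IsHermitian, Matrix.conjTranspose_eq_transpose_of_trivial]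
  rw [numDistinctEigenvalues, setOf_hasEigenvalue_eq_rootSet_minpoly,
    ← Nat.card_coe_set_eq, Nat.card_eq_fintype_card]
  refine card_rootSet_eq_natDegree (separable_minpoly_of_isHermitian hH) ?_
  exact (splits_minpoly_of_isHermitian hH).map _

theorem numDistinctEigenvalues_le_rank_add_one (A : Matrix V V ℝ) :
    numDistinctEigenvalues A ≤ A.rank + 1 := by
  set S := {μ | Module.End.HasEigenvalue (Matrix.toLin' A) μ}
  choose x hx using fun μ : (S \ {0} : Set ℝ) => μ.2.1.exists_hasEigenvector
  have hrange (μ) : x μ ∈ LinearMap.range (Matrix.toLin' A) :=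
    ⟨(μ : ℝ)⁻¹ • x μ, by rw [map_smul, (hx μ).apply_eq_smul, inv_smul_smul₀ μ.2.2]⟩
  have hli : LinearIndependent ℝ fun μ => (⟨x μ, hrange μ⟩ : LinearMap.range (Matrix.toLin' A)) :=
    .of_comp (Submodule.subtype _) (Module.End.eigenvectors_linearIndependent _ _ x hx)
  have hcard : (S \ {0}).ncard ≤ A.rank := by
    have hfin : (S \ {0}).Finite := (Module.End.finite_hasEigenvalue _).subset Set.sdiff_subset
    have := hfin.fintype
    rw [← Nat.card_coe_set_eq, Nat.card_eq_fintype_card]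
    exact hli.fintype_card_le_finrank
  exact (Set.ncard_le_ncard_sdiff_add_ncard S {0} (Set.finite_singleton 0)).trans (by simpa)

theorem numDistinctEigenvalues_submatrix_equiv (e : W ≃ V) (A : Matrix V V ℝ) :
    numDistinctEigenvalues (A.submatrix e e) = numDistinctEigenvalues A := by
  have h : A.submatrix e e = Matrix.reindexAlgEquiv ℝ ℝ e.symm A := rfl
  simp only [numDistinctEigenvalues, setOf_hasEigenvalue_eq_rootSet_minpoly, h, minpoly.algEquiv_eq]

theorem minDistinctEigenvalues_le_of_mem {G : SimpleGraph V} {A : Matrix V V ℝ}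
    (hA : A ∈ SymMatricesOf G) : minDistinctEigenvalues G ≤ numDistinctEigenvalues A :=
  Nat.sInf_le ⟨A, hA, rfl⟩

theorem exists_numDistinctEigenvalues_eq (G : SimpleGraph V) :
    ∃ A ∈ SymMatricesOf G, numDistinctEigenvalues A = minDistinctEigenvalues G :=
  Nat.sInf_mem ((symMatricesOf_nonempty G).image _)

theorem minDistinctEigenvalues_le_of_iso {G : SimpleGraph V} {H : SimpleGraph W} (e : G ≃g H) :
    minDistinctEigenvalues G ≤ minDistinctEigenvalues H := by
  obtain ⟨A, ⟨hs, hA⟩, h⟩ := exists_numDistinctEigenvalues_eq H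
  rw [← h, ← numDistinctEigenvalues_submatrix_equiv e.toEquiv]
  refine minDistinctEigenvalues_le_of_mem ⟨hs.submatrix _, fun i j hij => ?_⟩
  rw [← e.map_adj_iff]
  exact hA _ _ (e.injective.ne hij)

theorem minDistinctEigenvalues_congr {G : SimpleGraph V} {H : SimpleGraph W} (e : G ≃g H) :
    minDistinctEigenvalues G = minDistinctEigenvalues H :=
  (minDistinctEigenvalues_le_of_iso e).antisymm (minDistinctEigenvalues_le_of_iso e.symm)

end Spectrum

section UpperBounds

/-- The graph of a symmetric matrix: its edges are the positions of the nonzero off-diagonal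
entries. -/
def supportGraph {V R : Type*} [Zero R] (A : Matrix V V R) : SimpleGraph V :=
  SimpleGraph.fromRel fun i j => A i j ≠ 0

instance {V R : Type*} [Zero R] [DecidableEq V] [DecidableEq R] (A : Matrix V V R) :
    DecidableRel (supportGraph A).Adj := fun i j =>
  decidable_of_iff _ (SimpleGraph.fromRel_adj _ i j).symm

theorem supportGraph_adj {V R : Type*} [Zero R] {A : Matrix V V R} (hA : A.IsSymm) {i j : V} :
    (supportGraph A).Adj i j ↔ i ≠ j ∧ A i j ≠ 0 := by
  rw [supportGraph, SimpleGraph.fromRel_adj, hA.apply, or_self]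

theorem supportGraph_adjMatrix {V : Type*} (G : SimpleGraph V) [DecidableRel G.Adj] :
    supportGraph (G.adjMatrix ℤ) = G := by
  ext i j
  simpa [supportGraph_adj G.isSymm_adjMatrix, adjMatrix_apply] using G.ne_of_adj

theorem map_intCast_mem_symMatricesOf {V : Type*} {A : Matrix V V ℤ} (hA : A.IsSymm) :
    A.map (Int.cast : ℤ → ℝ) ∈ SymMatricesOf (supportGraph A) :=
  ⟨hA.map _, fun i j hij => by simp [supportGraph_adj hA, hij]⟩

theorem minDistinctEigenvalues_supportGraph_le {V : Type*} [Fintype V] [DecidableEq V]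
    {A : Matrix V V ℤ} (hA : A.IsSymm) {p : ℤ[X]} (hp : p.Monic) (h : aeval A p = 0) :
    minDistinctEigenvalues (supportGraph A) ≤ p.natDegree := by
  have hann : aeval (A.map (Int.cast : ℤ → ℝ)) (p.map (Int.castRingHom ℝ)) = 0 := by
    have hmap := map_aeval_eq_aeval_map (φ := Int.castRingHom ℝ)
      (ψ := (Int.castRingHom ℝ).mapMatrix) (by ext; simp) p A
    rw [h, map_zero] at hmap
    exact hmap.symm
  calc minDistinctEigenvalues (supportGraph A)
      ≤ numDistinctEigenvalues (A.map (Int.cast : ℤ → ℝ)) :=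
        minDistinctEigenvalues_le_of_mem (map_intCast_mem_symMatricesOf hA)
    _ ≤ (p.map (Int.castRingHom ℝ)).natDegree :=
        numDistinctEigenvalues_le_natDegree (hp.map _).ne_zero hann
    _ = p.natDegree := hp.natDegree_map _

variable {V ι κ : Type*}

/-- The matrix whose columns are the indicator vectors of the sets `s i`. -/
noncomputable def indicatorMatrix (s : ι → Set V) : Matrix V ι ℝ :=
  Matrix.of fun v i => (s i).indicator 1 v

variable [Fintype ι] [Fintype κ]

theorem indicatorMatrix_mul_transpose_ne_zero_iff (s t : ι → Set V) (u v : V) :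
    (indicatorMatrix s * (indicatorMatrix t).transpose) u v ≠ 0 ↔ ∃ i, u ∈ s i ∧ v ∈ t i := by
  rw [Matrix.mul_apply, ne_eq, Finset.sum_eq_zero_iff_of_nonneg fun _ _ =>
    mul_nonneg (Set.indicator_nonneg (by simp) _) (Set.indicator_nonneg (by simp) _)]
  simp [indicatorMatrix]

/-- Every clique of the cover contributes a matrix of rank one, and every complete bipartite graph
one of rank two; since all entries are nonnegative, nothing cancels in the sum. -/
theorem minDistinctEigenvalues_le_of_cover [Fintype V] [DecidableEq V] {G : SimpleGraph V}
    (K : ι → Set V) (L R : κ → Set V)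
    (hG : ∀ u v, u ≠ v → (G.Adj u v ↔ (∃ i, u ∈ K i ∧ v ∈ K i) ∨
      (∃ j, u ∈ L j ∧ v ∈ R j) ∨ ∃ j, u ∈ R j ∧ v ∈ L j)) :
    minDistinctEigenvalues G ≤ Fintype.card ι + 2 * Fintype.card κ + 1 := by
  set s : ι ⊕ κ ⊕ κ → Set V := Sum.elim K (Sum.elim L R)
  set t : ι ⊕ κ ⊕ κ → Set V := Sum.elim K (Sum.elim R L)
  set A : Matrix V V ℝ := indicatorMatrix s * (indicatorMatrix t).transpose with hA
  have hmem : A ∈ SymMatricesOf G := by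
    refine ⟨Matrix.IsSymm.ext fun u v => ?_, fun u v huv => ?_⟩
    · simp only [hA, Matrix.mul_apply, Fintype.sum_sum_type, Matrix.transpose_apply,
        indicatorMatrix, Matrix.of_apply, s, t, Sum.elim_inl, Sum.elim_inr]
      simp only [mul_comm, add_comm]
    · rw [hA, indicatorMatrix_mul_transpose_ne_zero_iff, hG u v huv]
      simp only [s, t, Sum.exists, Sum.elim_inl, Sum.elim_inr]
  have hrank : A.rank ≤ Fintype.card ι + 2 * Fintype.card κ := by
    refine (Matrix.rank_mul_le_left _ _).trans ((Matrix.rank_le_card_width _).trans_eq ?_)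
    rw [Fintype.card_sum, Fintype.card_sum, two_mul]
  calc minDistinctEigenvalues G ≤ numDistinctEigenvalues A := minDistinctEigenvalues_le_of_mem hmem
    _ ≤ A.rank + 1 := numDistinctEigenvalues_le_rank_add_one A
    _ ≤ Fintype.card ι + 2 * Fintype.card κ + 1 := by gcongr

end UpperBounds

/-- `p` is the only shortest path from `p 0` to each of its vertices, as witnessed by a labelling
`ℓ` that grows by at most `1` along each edge and by exactly `1` along the edges of `p`. -/
structure IsUniqueGeodesic {V : Type*} (G : SimpleGraph V) {d : ℕ} (ℓ : V → ℕ)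
    (p : Fin (d + 1) → V) : Prop where
  label_apply : ∀ k, ℓ (p k) = k
  label_le : ∀ u v, G.Adj u v → ℓ v ≤ ℓ u + 1
  adj : ∀ k : Fin d, G.Adj (p k.castSucc) (p k.succ)
  eq_of_adj : ∀ (k : Fin d) u, G.Adj u (p k.succ) → ℓ u ≤ k → u = p k.castSucc

namespace IsUniqueGeodesic

variable {V : Type*} [Fintype V] [DecidableEq V] {G : SimpleGraph V} {d : ℕ} {ℓ : V → ℕ}
  {p : Fin (d + 1) → V} {A : Matrix V V ℝ}

theorem pow_apply_eq_zero (hp : IsUniqueGeodesic G ℓ p) (hA : A ∈ SymMatricesOf G) {k : ℕ} {v : V}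
    (hv : k < ℓ v) : (A ^ k) (p 0) v = 0 := by
  induction k generalizing v with
  | zero =>
    refine Matrix.one_apply_ne ?_
    rintro rfl
    simp [hp.label_apply] at hv
  | succ k ih =>
    rw [pow_succ, Matrix.mul_apply]
    refine Finset.sum_eq_zero fun u _ => ?_
    obtain hu | hu := lt_or_ge k (ℓ u)
    · rw [ih hu, zero_mul]
    · have hadj : ¬ G.Adj u v := fun h => by have := hp.label_le u v h; omega
      have huv : u ≠ v := by rintro rfl; omega
      rw [not_not.mp (mt (hA.2 u v huv).mp hadj), mul_zero]

theorem pow_apply_succ (hp : IsUniqueGeodesic G ℓ p) (hA : A ∈ SymMatricesOf G) (k : Fin d) :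
    (A ^ (k.succ : ℕ)) (p 0) (p k.succ) =
      (A ^ (k : ℕ)) (p 0) (p k.castSucc) * A (p k.castSucc) (p k.succ) := by
  rw [Fin.val_succ, pow_succ, Matrix.mul_apply]
  refine Fintype.sum_eq_single _ fun u hu => ?_
  obtain hk | hk := lt_or_ge (k : ℕ) (ℓ u)
  · rw [hp.pow_apply_eq_zero hA hk, zero_mul]
  · have hadj : ¬ G.Adj u (p k.succ) := fun h => hu (hp.eq_of_adj k u h hk)
    have huv : u ≠ p k.succ := by
      rintro rfl
      simp [hp.label_apply] at hk
    rw [not_not.mp (mt (hA.2 _ _ huv).mp hadj), mul_zero]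

theorem pow_apply_ne_zero (hp : IsUniqueGeodesic G ℓ p) (hA : A ∈ SymMatricesOf G)
    (k : Fin (d + 1)) : (A ^ (k : ℕ)) (p 0) (p k) ≠ 0 := by
  induction k using Fin.induction with
  | zero => simp
  | succ k ih =>
    rw [hp.pow_apply_succ hA]
    exact mul_ne_zero ih ((hA.2 _ _ (hp.adj k).ne).mpr (hp.adj k))

theorem lt_natDegree_of_aeval_eq_zero (hp : IsUniqueGeodesic G ℓ p) (hA : A ∈ SymMatricesOf G)
    {f : ℝ[X]} (hf : f ≠ 0) (h : aeval A f = 0) : d < f.natDegree := by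
  by_contra! hle
  obtain ⟨m, hm⟩ : ∃ m : Fin (d + 1), (m : ℕ) = f.natDegree := ⟨⟨_, Nat.lt_succ_of_le hle⟩, rfl⟩
  have hentry : (aeval A f) (p 0) (p m) = f.leadingCoeff * (A ^ (m : ℕ)) (p 0) (p m) := by
    rw [aeval_eq_sum_range, Finset.sum_range_succ, Matrix.add_apply, Matrix.sum_apply,
      Finset.sum_eq_zero, zero_add, leadingCoeff, hm, Matrix.smul_apply, smul_eq_mul]
    intro k hk
    have hk' : k < ℓ (p m) := by rwa [hp.label_apply, hm, ← Finset.mem_range]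
    rw [Matrix.smul_apply, hp.pow_apply_eq_zero hA hk', smul_zero]
  rw [h, Matrix.zero_apply] at hentry
  exact mul_ne_zero (leadingCoeff_ne_zero.mpr hf) (hp.pow_apply_ne_zero hA m) hentry.symm

theorem lt_minDistinctEigenvalues (hp : IsUniqueGeodesic G ℓ p) : d < minDistinctEigenvalues G := by
  obtain ⟨A, hA, hq⟩ := exists_numDistinctEigenvalues_eq G
  rw [← hq, numDistinctEigenvalues_eq_natDegree_minpoly hA.1]
  exact hp.lt_natDegree_of_aeval_eq_zero hA (minpoly.ne_zero (Matrix.isIntegral A))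
    (minpoly.aeval ℝ A)

end IsUniqueGeodesic

section Families

theorem pathGraph_isUniqueGeodesic (d : ℕ) :
    IsUniqueGeodesic (pathGraph (d + 1)) Fin.val (id : Fin (d + 1) → Fin (d + 1)) where
  label_apply _ := rfl
  label_le u v h := by rw [pathGraph_adj] at h; omega
  adj k := by simp [pathGraph_adj]
  eq_of_adj k u h hk := by
    simp only [pathGraph_adj, id, Fin.val_succ] at h
    simp only [id, Fin.ext_iff, Fin.val_castSucc]
    omega

theorem le_minDistinctEigenvalues_pathGraph (n : ℕ) : n ≤ minDistinctEigenvalues (pathGraph n) := by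
  cases n with
  | zero => exact Nat.zero_le _
  | succ d => exact (pathGraph_isUniqueGeodesic d).lt_minDistinctEigenvalues

theorem pathWithChord_adj {n i : ℕ} {a b : Fin n} :
    (pathWithChord n i).Adj a b ↔ a.val + 1 = b ∨ b.val + 1 = a ∨
      (a.val + 1 = i ∧ b.val = i + 1) ∨ (b.val + 1 = i ∧ a.val = i + 1) := by
  rw [pathWithChord, SimpleGraph.fromRel_adj, ne_eq, Fin.ext_iff]
  omega

theorem pathWithPendant_adj {n i : ℕ} {a b : Fin n} (hi : i < n) :
    (pathWithPendant n i).Adj a b ↔ (a.val + 1 = b ∧ b.val + 1 < n) ∨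
      (b.val + 1 = a ∧ a.val + 1 < n) ∨
      (a.val + 1 = i ∧ b.val + 1 = n) ∨ (b.val + 1 = i ∧ a.val + 1 = n) := by
  rw [pathWithPendant, SimpleGraph.fromRel_adj, ne_eq, Fin.ext_iff]
  omega

/-- The path skips `v_{i+1}`, which is as far from `v_1` as `v_{i+2}`. -/
theorem pathWithChord_isUniqueGeodesic {d i : ℕ} (hi : 1 ≤ i) (hid : i ≤ d) :
    IsUniqueGeodesic (pathWithChord (d + 2) i)
      (fun a : Fin (d + 2) => if a.val ≤ i then a.val else a.val - 1)
      (Fin.succAbove ⟨i, by omega⟩) where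
  label_apply k := by simp only [Fin.succAbove, Fin.lt_def]; grind
  label_le u v h := by rw [pathWithChord_adj] at h; grind
  adj k := by simp only [pathWithChord_adj, Fin.succAbove, Fin.lt_def]; grind
  eq_of_adj k u h hk := by
    simp only [pathWithChord_adj, Fin.succAbove, Fin.lt_def, Fin.ext_iff] at h ⊢
    grind

theorem pathWithPendant_isUniqueGeodesic {d i : ℕ} (hid : i ≤ d) :
    IsUniqueGeodesic (pathWithPendant (d + 2) i)
      (fun a : Fin (d + 2) => if a.val ≤ d then a.val else i) Fin.castSucc where
  label_apply k := by simp only [Fin.val_castSucc]; grind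
  label_le u v h := by rw [pathWithPendant_adj (by omega)] at h; grind
  adj k := by rw [pathWithPendant_adj (by omega)]; grind
  eq_of_adj k u h hk := by
    rw [pathWithPendant_adj (by omega)] at h
    simp only [Fin.ext_iff]
    grind

theorem minDistinctEigenvalues_pathWithChord_le {d i : ℕ} (hi : 1 ≤ i) (hid : i ≤ d) :
    minDistinctEigenvalues (pathWithChord (d + 2) i) ≤ d + 1 := by
  -- The triangle on `v_i`, `v_{i+1}`, `v_{i+2}` covers three edges by a matrix of rank one.
  let K (r : Fin d) : Set (Fin (d + 2)) :=
    {a | (r.val + 1 ≤ i ∧ a = r.val) ∨ a.val = r + 1 ∨ (i ≤ r.val + 1 ∧ a.val = r + 2)}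
  have hcover (a b : Fin (d + 2)) (hab : a ≠ b) :
      (pathWithChord (d + 2) i).Adj a b ↔ ∃ r, a ∈ K r ∧ b ∈ K r := by
    rw [pathWithChord_adj]
    simp only [K, Set.mem_ofPred_eq]
    constructor
    · intro h
      exact ⟨⟨if min a.val b < i then min a.val b else min a.val b - 1, by grind⟩, by grind⟩
    · grind
  simpa using minDistinctEigenvalues_le_of_cover K Empty.elim Empty.elim (by simpa using hcover)

theorem minDistinctEigenvalues_pathWithPendant_le {d i : ℕ} (hi : 2 ≤ i) (hid : i ≤ d) :
    minDistinctEigenvalues (pathWithPendant (d + 2) i) ≤ d + 1 := by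
  let x : Fin d := ⟨i - 2, by omega⟩
  let y : Fin d := ⟨i - 1, by omega⟩
  let K (r : ↥({x, y}ᶜ : Finset (Fin d))) : Set (Fin (d + 2)) :=
    {a | a = r.1.val ∨ a = r.1.val + 1}
  -- The star at `v_i` covers three edges by a matrix of rank two.
  let L (_ : Unit) : Set (Fin (d + 2)) := {a | a.val + 1 = i}
  let R (_ : Unit) : Set (Fin (d + 2)) := {a | a.val + 2 = i ∨ a = i ∨ a = d + 1}
  have hcover (a b : Fin (d + 2)) (hab : a ≠ b) :
      (pathWithPendant (d + 2) i).Adj a b ↔ (∃ r, a ∈ K r ∧ b ∈ K r) ∨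
        (∃ j, a ∈ L j ∧ b ∈ R j) ∨ ∃ j, a ∈ R j ∧ b ∈ L j := by
    rw [pathWithPendant_adj (by omega)]
    simp only [K, L, R, Set.mem_ofPred_eq, exists_const]
    constructor
    · intro h
      by_cases hr : a.val + 1 = i ∨ b.val + 1 = i
      · grind
      · let k : Fin d := ⟨min a.val b, by grind⟩
        have hk : k ∈ ({x, y}ᶜ : Finset (Fin d)) := by
          simp only [Finset.mem_compl, Finset.mem_insert, Finset.mem_singleton, Fin.ext_iff,
            x, y, k]
          grind
        exact .inl ⟨⟨k, hk⟩, by grind⟩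
    · grind
  have hxy : x ≠ y := by simp only [x, y, ne_eq, Fin.ext_iff]; omega
  have hcard : Fintype.card ↥({x, y}ᶜ : Finset (Fin d)) = d - 2 := by
    rw [Fintype.card_coe, Finset.card_compl, Finset.card_pair hxy, Fintype.card_fin]
  calc _ ≤ (d - 2) + 2 * 1 + 1 := by
        rw [← hcard, ← Fintype.card_unit]
        exact minDistinctEigenvalues_le_of_cover K L R hcover
    _ = d + 1 := by omega

theorem minDistinctEigenvalues_pathWithChord {d i : ℕ} (hi : 1 ≤ i) (hid : i ≤ d) :
    minDistinctEigenvalues (pathWithChord (d + 2) i) = d + 1 :=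
  (minDistinctEigenvalues_pathWithChord_le hi hid).antisymm
    (pathWithChord_isUniqueGeodesic hi hid).lt_minDistinctEigenvalues

theorem minDistinctEigenvalues_pathWithPendant {d i : ℕ} (hi : 2 ≤ i) (hid : i ≤ d) :
    minDistinctEigenvalues (pathWithPendant (d + 2) i) = d + 1 :=
  (minDistinctEigenvalues_pathWithPendant_le hi hid).antisymm
    (pathWithPendant_isUniqueGeodesic hid).lt_minDistinctEigenvalues

end Families

section Certificates

/-- One pair `(A, c)` for each connected graph on `n ≤ 5` vertices with `q(G) ≤ n - 2`: the matrix
`A` lies in `S(G)`, and `A ^ (n - 2)` is the combination of the lower powers of `A` with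
coefficients `c`. -/
def certificates : (n : ℕ) → List (Matrix (Fin n) (Fin n) ℤ × (Fin (n - 2) → ℤ))
  | 4 => [
    (!![0, 0, 1, 1; 0, 0, -1, 1; 1, -1, -1, 0; 1, 1, 0, -1], ![2, -1]),
    (!![0, 1, 1, 1; 1, 0, 1, -1; 1, 1, -1, 0; 1, -1, 0, 1], ![3, 0]),
    (!![1, 1, 1, 1; 1, 1, 1, 1; 1, 1, 1, 1; 1, 1, 1, 1], ![0, 4])]
  | 5 => [
    (!![0, -1, 0, 1, 3; -1, 2, 2, 0, 0; 0, 2, -3, 2, 0; 1, 0, 2, 2, 0; 3, 0, 0, 0, -2],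
      ![-14, 15, 0]),
    (!![0, 1, -1, 0, 1; 1, 0, 1, 0, 0; -1, 1, 0, 1, 0; 0, 0, 1, -1, 1; 1, 0, 0, 1, -1],
      ![0, 3, -1]),
    (!![0, 1, 0, -1, 1; 1, 1, 1, 1, 0; 0, 1, -1, 1, 0; -1, 1, 1, 1, 0; 1, 0, 0, 0, 2],
      ![-4, 3, 2]),
    (!![0, 1, 2, 2, 2; 1, -1, 2, 0, 0; 2, 2, -1, 3, 0; 2, 0, 3, 0, 0; 2, 0, 0, 0, -3],
      ![15, 22, 0]),
    (!![0, 2, 0, 0, -1; 2, 2, 2, 0, 1; 0, 2, 2, 2, 1; 0, 0, 2, 0, -1; -1, 1, 1, -1, 1],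
      ![-20, 4, 5]),
    (!![0, 1, 1, 1, 1; 1, -1, 1, 0, 0; 1, 1, -1, 0, 0; 1, 0, 0, 0, 0; 1, 0, 0, 0, 0],
      ![0, 4, 0]),
    (!![0, 1, 0, 0, 1; 1, 0, 1, 0, 0; 0, 1, 0, 1, 0; 0, 0, 1, 0, 1; 1, 0, 0, 1, 0],
      ![-2, 3, 1]),
    (!![0, 0, 1, 1, 1; 0, 0, 1, 1, 1; 1, 1, 0, 0, 0; 1, 1, 0, 0, 0; 1, 1, 0, 0, 0],
      ![0, 6, 0]),
    (!![0, 1, 1, 1, 1; 1, 0, 1, 1, 1; 1, 1, -1, 0, 0; 1, 1, 0, -1, 0; 1, 1, 0, 0, -1],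
      ![7, 7, -1]),
    (!![0, 1, 1, 1, 1; 1, 0, 0, 0, 0; 1, 0, 0, 0, 0; 1, 0, 0, 0, 0; 1, 0, 0, 0, 0],
      ![0, 4, 0]),
    (!![0, 1, -1, -1, 1; 1, 1, 1, 0, 0; -1, 1, 1, 0, 0; -1, 0, 0, 1, 1; 1, 0, 0, 1, 1],
      ![0, 4, 0]),
    (!![0, 1, 1, 1, 1; 1, 1, 1, 1, 0; 1, 1, 1, 1, 0; 1, 1, 1, 1, 0; 1, 0, 0, 0, -1],
      ![0, 7, 2]),
    (!![0, 0, 1, 1, 1; 0, 0, 1, 1, 1; 1, 1, 1, 1, 0; 1, 1, 1, 1, 0; 1, 1, 0, 0, -1],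
      ![0, 8, 1]),
    (!![0, 1, 0, 1, 1; 1, 0, 1, 0, -1; 0, 1, 0, 1, 1; 1, 0, 1, 0, -1; 1, -1, 1, -1, 1],
      ![0, 6, -1]),
    (!![0, 0, 0, -1, 1; 0, 1, -1, 1, 1; 0, -1, -1, 1, 1; -1, 1, 1, -1, 1; 1, 1, 1, 1, -1],
      ![-4, 6, 0]),
    (!![0, 0, 1, 1, 1; 0, 0, 1, 1, 1; 1, 1, -1, 1, 1; 1, 1, 1, -1, 1; 1, 1, 1, 1, -1],
      ![0, 6, 1]),
    (!![1, 1, 1, 1, 1; 1, 1, 1, 1, 1; 1, 1, 1, 1, 1; 1, 1, 1, 1, 1; 1, 1, 1, 1, 1],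
      ![0, 0, 5])]
  | _ => []

theorem certificates_spec : ∀ n ≤ 5, ∀ x ∈ certificates n,
    x.1.transpose = x.1 ∧ x.1 ^ (n - 2) = ∑ k, x.2 k • x.1 ^ (k : ℕ) := by
  decide +kernel

theorem minDistinctEigenvalues_supportGraph_le_of_pow_eq_sum {V : Type*} [Fintype V]
    [DecidableEq V] {A : Matrix V V ℤ} (hA : A.IsSymm) {d : ℕ} {c : Fin d → ℤ}
    (h : A ^ d = ∑ k, c k • A ^ (k : ℕ)) : minDistinctEigenvalues (supportGraph A) ≤ d := by
  let E : LinearRecurrence ℤ := ⟨d, c⟩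
  have hann : aeval A E.charPoly = 0 := by
    simp [LinearRecurrence.charPoly, E, aeval_monomial, h]
  refine (minDistinctEigenvalues_supportGraph_le hA E.charPoly_monic hann).trans_eq ?_
  exact natDegree_eq_of_degree_eq_some E.charPoly_degree_eq_order

theorem minDistinctEigenvalues_certificate_add_two_le {n : ℕ} (hn : n ≤ 5)
    {x : Matrix (Fin n) (Fin n) ℤ × (Fin (n - 2) → ℤ)} (hx : x ∈ certificates n) :
    minDistinctEigenvalues (supportGraph x.1) + 2 ≤ n := by
  obtain ⟨hsymm, hpow⟩ := certificates_spec n hn x hx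
  have hle := minDistinctEigenvalues_supportGraph_le_of_pow_eq_sum hsymm hpow
  have h2 : 2 ≤ n := by
    by_contra!
    interval_cases n <;> simp [certificates] at hx
  omega

end Certificates

section Classification

instance (n : ℕ) : DecidableRel (pathGraph n).Adj := fun _ _ =>
  decidable_of_iff _ pathGraph_adj.symm

instance (n i : ℕ) : DecidableRel (pathWithChord n i).Adj := fun a b =>
  decidable_of_iff _ (SimpleGraph.fromRel_adj _ a b).symm

instance (n i : ℕ) : DecidableRel (pathWithPendant n i).Adj := fun a b =>
  decidable_of_iff _ (SimpleGraph.fromRel_adj _ a b).symm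

/-- The graph obtained from `H` by adding a new vertex `0` joined to the vertices in `s`. -/
def attachVertex {n : ℕ} (H : SimpleGraph (Fin n)) (s : Finset (Fin n)) :
    SimpleGraph (Fin (n + 1)) where
  Adj := Fin.cons (Fin.cons False (· ∈ s)) fun a => Fin.cons (a ∈ s) (H.Adj a)
  symm := ⟨fun i j => by cases i using Fin.cases <;> cases j using Fin.cases <;> simp [H.adj_comm]⟩
  loopless := ⟨fun i => by cases i using Fin.cases <;> simp⟩

instance {n : ℕ} (H : SimpleGraph (Fin n)) [DecidableRel H.Adj] (s : Finset (Fin n)) :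
    DecidableRel (attachVertex H s).Adj :=
  Fin.cases (Fin.cases (inferInstanceAs (Decidable False))
    fun b => inferInstanceAs (Decidable (b ∈ s))) fun a =>
    Fin.cases (inferInstanceAs (Decidable (a ∈ s))) fun b => inferInstanceAs (Decidable (H.Adj a b))

/-- If `H` is a copy of `G` without the vertex `v`, attaching a vertex to `H` at the neighbours `s`
of `v` gives `G` back. -/
def attachVertexIso {V : Type*} [DecidableEq V] {G : SimpleGraph V} {v : V} {n : ℕ}
    {H : SimpleGraph (Fin n)} (e : G.induce {v}ᶜ ≃g H) (s : Finset (Fin n))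
    (hs : ∀ a, a ∈ s ↔ G.Adj v (e.symm a)) : attachVertex H s ≃g G where
  toEquiv := (finSuccEquiv n).trans (e.symm.toEquiv.optionCongr.trans (Equiv.optionSubtypeNe v))
  map_rel_iff' {i j} := by
    cases i using Fin.cases <;> cases j using Fin.cases
    · exact iff_of_false G.irrefl not_false
    · exact (hs _).symm
    · exact (G.adj_comm _ _).trans (hs _).symm
    · exact e.symm.map_adj_iff

theorem exists_iso_attachVertex {V : Type*} [Nontrivial V] {G : SimpleGraph V}
    (hG : G.Preconnected) {v : V} {n : ℕ} {H : SimpleGraph (Fin n)} (e : G.induce {v}ᶜ ≃g H) :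
    ∃ s : Finset (Fin n), s.Nonempty ∧ Nonempty (G ≃g attachVertex H s) := by
  classical
  obtain ⟨w, hw⟩ := hG.exists_adj_of_nontrivial v
  let s : Finset (Fin n) := {a | G.Adj v (e.symm a)}
  have hs (a) : a ∈ s ↔ G.Adj v (e.symm a) := by simp [s]
  exact ⟨s, ⟨e ⟨w, hw.ne'⟩, by simpa [hs] using hw⟩, ⟨(attachVertexIso e s hs).symm⟩⟩

/-- For `1 ≤ n ≤ 5`, one matrix for each isomorphism class of connected graphs on `n` vertices.
Reversing the path turns the index `i` into `n - 1 - i` for a chord and into `n - i` for a pendant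
vertex, so half of the indices suffice. -/
def catalogue (n : ℕ) : List (Matrix (Fin n) (Fin n) ℤ) :=
  (pathGraph n).adjMatrix ℤ ::
    ((List.range' 1 ((n - 1) / 2)).map fun i => (pathWithChord n i).adjMatrix ℤ) ++
    ((List.range' 2 (n / 2 - 1)).map fun i => (pathWithPendant n i).adjMatrix ℤ) ++
    (certificates n).map Prod.fst

-- Comparing degree sequences first keeps the search over permutations short.
set_option maxRecDepth 100000 in
theorem catalogue_attachVertex : ∀ n ∈ Finset.Icc 1 4, ∀ A ∈ catalogue n,
    ∀ s : Finset (Fin n), s.Nonempty → ∃ B ∈ catalogue (n + 1),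
      (Finset.univ.val.map fun i => (attachVertex (supportGraph A) s).degree i) =
        (Finset.univ.val.map fun i => (supportGraph B).degree i) ∧
      ∃ σ : Equiv.Perm (Fin (n + 1)), ∀ i j,
        (attachVertex (supportGraph A) s).Adj i j ↔ (supportGraph B).Adj (σ i) (σ j) := by
  decide +kernel

theorem exists_iso_supportGraph_attachVertex {n : ℕ} (hn : n ∈ Finset.Icc 1 4)
    {A : Matrix (Fin n) (Fin n) ℤ} (hA : A ∈ catalogue n) {s : Finset (Fin n)} (hs : s.Nonempty) :
    ∃ B ∈ catalogue (n + 1), Nonempty (attachVertex (supportGraph A) s ≃g supportGraph B) :=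
  have ⟨B, hB, _, σ, hσ⟩ := catalogue_attachVertex n hn A hA s hs
  ⟨B, hB, ⟨σ, (hσ _ _).symm⟩⟩

theorem exists_iso_supportGraph_catalogue {n : ℕ} (h1 : 1 ≤ n) (h5 : n ≤ 5) {V : Type*}
    [Finite V] {G : SimpleGraph V} (hG : G.Connected) (hV : Nat.card V = n) :
    ∃ A ∈ catalogue n, Nonempty (G ≃g supportGraph A) := by
  induction n, h1 using Nat.le_induction generalizing V with
  | base =>
    refine ⟨(pathGraph 1).adjMatrix ℤ, List.mem_cons_self, ?_⟩
    rw [supportGraph_adjMatrix]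
    have e : V ≃ Fin 1 := Finite.equivFinOfCardEq hV
    exact ⟨Subsingleton.elim (G.map e.toEmbedding) (pathGraph 1) ▸ Iso.map e G⟩
  | succ n h1 ih =>
    have : Nontrivial V := Finite.one_lt_card_iff_nontrivial.mp (by omega)
    obtain ⟨v, hv⟩ := hG.exists_connected_induce_compl_singleton_of_finite_nontrivial
    have hcard : Nat.card ↥({v}ᶜ : Set V) = n := by
      rw [Nat.card_coe_set_eq, Set.ncard_compl, Set.ncard_singleton, hV, Nat.add_sub_cancel]
    obtain ⟨A, hA, ⟨e⟩⟩ := ih (by omega) hv hcard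
    obtain ⟨s, hs, ⟨f⟩⟩ := exists_iso_attachVertex hG.preconnected e
    obtain ⟨B, hB, ⟨g⟩⟩ :=
      exists_iso_supportGraph_attachVertex (Finset.mem_Icc.mpr ⟨h1, by omega⟩) hA hs
    exact ⟨B, hB, ⟨f.trans g⟩⟩

theorem iso_pathGraph_or_chord_or_pendant_or_certificate {n : ℕ} (hn : n ≤ 5) {V : Type*}
    [Finite V] {G : SimpleGraph V} (hG : G.Connected) (hV : Nat.card V = n) :
    Nonempty (G ≃g pathGraph n) ∨
      (∃ i, 1 ≤ i ∧ i + 2 ≤ n ∧ Nonempty (G ≃g pathWithChord n i)) ∨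
      (∃ i, 2 ≤ i ∧ i + 2 ≤ n ∧ Nonempty (G ≃g pathWithPendant n i)) ∨
      ∃ x ∈ certificates n, Nonempty (G ≃g supportGraph x.1) := by
  have := hG.nonempty
  have hpos : 0 < n := hV ▸ Finite.card_pos
  obtain ⟨A, hA, ⟨e⟩⟩ := exists_iso_supportGraph_catalogue hpos hn hG hV
  simp only [catalogue, List.cons_append, List.mem_cons, List.mem_append, List.mem_map,
    List.mem_range'_1] at hA
  obtain rfl | (⟨i, hi, rfl⟩ | ⟨i, hi, rfl⟩) | ⟨x, hx, rfl⟩ := hA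
  · exact .inl ⟨supportGraph_adjMatrix (pathGraph n) ▸ e⟩
  · exact .inr (.inl ⟨i, hi.1, by omega, ⟨supportGraph_adjMatrix (pathWithChord n i) ▸ e⟩⟩)
  · exact .inr (.inr (.inl ⟨i, hi.1, by omega, ⟨supportGraph_adjMatrix (pathWithPendant n i) ▸ e⟩⟩))
  · exact .inr (.inr (.inr ⟨x, hx, ⟨e⟩⟩))

end Classification

theorem theorem7p6 {V : Type*} [Fintype V] [DecidableEq V] (G : SimpleGraph V)
    (hG : G.Connected) (hcard : Fintype.card V ≤ 5) :
    minDistinctEigenvalues G + 1 = Fintype.card V ↔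
      (∃ i : ℕ, 1 ≤ i ∧ i + 2 ≤ Fintype.card V ∧
        Nonempty (G ≃g pathWithChord (Fintype.card V) i)) ∨
      (∃ i : ℕ, 2 ≤ i ∧ i + 2 ≤ Fintype.card V ∧
        Nonempty (G ≃g pathWithPendant (Fintype.card V) i)) := by
  generalize hV : Fintype.card V = n at hcard ⊢
  constructor
  · intro hq
    obtain ⟨⟨e⟩⟩ | hchord | hpendant | ⟨x, hx, ⟨e⟩⟩ :=
      iso_pathGraph_or_chord_or_pendant_or_certificate hcard hG (Nat.card_eq_fintype_card.trans hV)
    · have hle := le_minDistinctEigenvalues_pathGraph n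
      rw [← minDistinctEigenvalues_congr e] at hle
      omega
    · exact .inl hchord
    · exact .inr hpendant
    · have hle := minDistinctEigenvalues_certificate_add_two_le hcard hx
      rw [← minDistinctEigenvalues_congr e] at hle
      omega
  · rintro (⟨i, hi, hin, ⟨e⟩⟩ | ⟨i, hi, hin, ⟨e⟩⟩) <;>
      obtain ⟨d, rfl⟩ : ∃ d, n = d + 2 := ⟨n - 2, by omega⟩ <;> rw [minDistinctEigenvalues_congr e]
    · rw [minDistinctEigenvalues_pathWithChord hi (by omega)]
    · rw [minDistinctEigenvalues_pathWithPendant hi (by omega)]
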